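/- Let $d\ge 1$. A uniform random tree of depth $k$ is built from the cell $[0,1]^d$ by $k$ rounds of splitting: in each round every cell is split in two, independently of everything else, by choosing a coordinate uniformly in $\{1,\dots,d\}$ and a cut point uniformly on the side of the cell in that coordinate. Let $K^{Un}_k(x,z)$ be the probability that $x,z\in[0,1]^d$ lie in the same one of the $2^k$ resulting cells. From a sample $(X_1,Y_1),\dots,(X_n,Y_n)$ form the translation-invariant uniform KeRF estimator \[ \tilde m^{Un}_{\infty,n}(x)=\frac{\sum_{i=1}^n Y_i\,K^{Un}_{k}(0,|X_i-x|)}{\sum_{i=1}^n K^{Un}_{k}(0,|X_i-x|)},\qquad x\in[0,1]^d, \] where $|\cdot|$ is taken coordinatewise, with depth \[ k=k(n)=\max\left\{1,\ \left\lceil \frac{\frac1{\log n}-1}{2\log_2\left(1-\frac1{3d}\right)-\left(1-\frac1{\log n}\right)}\ \log_2\frac{n}{(\log n)^{\frac{1/\log n}{1-1/\log n}}}\right\rceil\right\}. \] Then $k(n)\to\infty$. Moreover, let $m:[0,1]^d\to\mathbb R$ be Lipschitz (for the distance $\sum_j|x_j-x'_j|$) and let $\sigma^2\ge 0$. There is a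 constant $\tilde C$ such that, for every $n>1$, if $(X_1,\epsilon_1),\dots,(X_n,\epsilon_n)$ are independent, $X_i$ is uniformly distributed on $[0,1]^d$, $\epsilon_i$ is a centred Gaussian of variance $\sigma^2$ independent of $X_i$, and $Y_i=m(X_i)+\epsilon_i$, then for every $x\in[0,1]^d$ \[ \mathbb E\bigl(\tilde m^{Un}_{\infty,n}(x)-m(x)\bigr)^2\le \tilde C\, n^{-\frac{1}{1+\frac32 d\log 2}}\,\log n , \] the expectation on the left being finite. -/

import Mathlib

open MeasureTheory ProbabilityTheory Filter
open scoped NNReal ENNReal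

noncomputable section

/-- The randomness of one split of a tree: the coordinate that is cut, uniform on the `d`
coordinates, and independently the relative position of the cut, uniform on `[0,1]`. -/
def splitLaw (d : ℕ) [NeZero d] : Measure (Fin d × ℝ) :=
  (PMF.uniformOfFintype (Fin d)).toMeasure.prod (volume.restrict (Set.Icc (0 : ℝ) 1))

instance (d : ℕ) [NeZero d] : IsProbabilityMeasure (splitLaw d) := by
  have : IsProbabilityMeasure (volume.restrict (Set.Icc (0 : ℝ) 1)) := ⟨by simp⟩
  unfold splitLaw
  infer_instance

/-- The law of a uniform random tree: independent splits attached to the nodes of the infinite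
binary tree. A node is a list of left (`false`) and right (`true`) turns, the latest one first. -/
def treeLaw (d : ℕ) [NeZero d] : Measure (List Bool → Fin d × ℝ) :=
  Measure.infinitePi fun _ : List Bool => splitLaw d

/-- A node of a tree together with its cell: the box with lower corner `lo` and upper corner
`hi`. -/
structure NodeCell (d : ℕ) where
  /-- the address of the node -/
  node : List Bool
  /-- the lower corner of the cell -/
  lo : Fin d → ℝ
  /-- the upper corner of the cell -/
  hi : Fin d → ℝ

/-- The node of level `k` of the tree `θ` whose cell contains the point `z` of `[0,1]^d`, starting
from the cell `[0,1]^d` at the root. A cell is cut in the selected coordinate at the selected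
relative position, and a point on the cut belongs to the lower half. -/
def nodeCell {d : ℕ} (θ : List Bool → Fin d × ℝ) (z : Fin d → ℝ) : ℕ → NodeCell d
  | 0 => ⟨[], fun _ => 0, fun _ => 1⟩
  | k + 1 =>
    let c := nodeCell θ z k
    let j := (θ c.node).1
    let s := c.lo j + (θ c.node).2 * (c.hi j - c.lo j)
    if z j ≤ s then ⟨false :: c.node, c.lo, Function.update c.hi j s⟩
    else ⟨true :: c.node, Function.update c.lo j s, c.hi⟩

/-- The kernel `K_k^{Un}(x, z)` of the infinite uniform random forest of depth `k`: the probability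
that `x` and `z` lie in the same one of the `2^k` cells of a uniform random tree. -/
def uniformKernel (d : ℕ) [NeZero d] (k : ℕ) (x z : Fin d → ℝ) : ℝ :=
  (treeLaw d).real {θ | (nodeCell θ x k).node = (nodeCell θ z k).node}

/-- The translation invariant uniform KeRF estimate at `x` from the sample
`(X 1, Y 1), …, (X n, Y n)`, with trees of depth `k`. -/
def uniformKeRF {d n : ℕ} [NeZero d] (k : ℕ) (X : Fin n → Fin d → ℝ) (Y : Fin n → ℝ)
    (x : Fin d → ℝ) : ℝ :=
  (∑ i, Y i * uniformKernel d k 0 (fun j => |X i j - x j|)) /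
    ∑ i, uniformKernel d k 0 (fun j => |X i j - x j|)

/-- The depth of the trees for sample size `n`; the outer maximum, which only matters for finitely
many `n`, makes it at least `1`. -/
def uniformDepth (d n : ℕ) : ℕ :=
  max 1 ⌈(1 / Real.log n - 1) /
      (2 * Real.logb 2 (1 - 1 / (3 * (d : ℝ))) - (1 - 1 / Real.log n)) *
    Real.logb 2 ((n : ℝ) / Real.log n ^ ((1 / Real.log n) / (1 - 1 / Real.log n)))⌉₊

end

/-! Along the leftmost path of a tree the cell of the origin is a box with upper corner `H`,
where `H j` is the product of the relative cut positions used in coordinate `j`. Hence for `z` in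
the cube the kernel `K(0, z)` is the probability that `z ≤ H` coordinatewise
(`uniformKernel_zero`). The splits on this path are independent, so moments of `H` are `k`-th
powers: `E ∏ H j = 2 ^ (-k)` and `E (H l * ∏ H j) = ((1 - 1 / (3 d)) / 2) ^ k`.

By Fubini, the mean weight `p = E K(0, |X - x|)` of a sample point is the mean volume of the part
of the cube within coordinatewise distance `H` of `x`, hence at least `2 ^ (-k)`, and the
weighted mean distance `q = E |X - x|₁ K(0, |X - x|)` is at most a constant times
`((1 - 1 / (3 d)) / 2) ^ k`, so that `q / p` is of order `(1 - 1 / (3 d)) ^ k`.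

Integrating out the Gaussian noise turns the mean squared error into the mean of a squared bias
plus `v` times the sum of the squared weights (`integral_kernelError_sq`). Both are bounded, as
the weights are nonnegative and sum to one, or all vanish. Where the sum of the kernels is at
least half of its mean `n p`, they are bounded through their numerators, whose second moments are
explicit; the complementary event has probability `O(1 / (n p))` by Chebyshev. This yields the
nonasymptotic bound `O(2 ^ k / n + (1 - 1 / (3 d)) ^ (2 k))` of `uniformKeRF_risk`.

The depth satisfies `k / log₂ n → a = 1 / (1 - 2 log₂ (1 - 1 / (3 d)))`, which balances the two
terms at `n ^ (a - 1 + o(1))`. Since `log y < y - 1` for `y = 1 - 1 / (3 d)`, the exponent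
`1 - a` is strictly larger than `1 / (1 + (3 / 2) d log 2)`, and this gap absorbs the `o(1)`. -/

/-! ### The cell of the origin -/

/-- The upper corner of the depth-`k` cell of the tree `θ` that contains the origin, as a product
over the first `k` nodes of the leftmost path: the node at level `i` shrinks the side in its own
coordinate by its relative cut position. -/
noncomputable def zeroCellCorner {d : ℕ} (k : ℕ) (θ : List Bool → Fin d × ℝ) (j : Fin d) : ℝ :=
  ∏ i ∈ Finset.range k,
    if (θ (List.replicate i false)).1 = j then (θ (List.replicate i false)).2 else 1

section Tree

variable {d : ℕ}

lemma zeroCellCorner_succ (k : ℕ) (θ : List Bool → Fin d × ℝ) (j : Fin d) :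
    zeroCellCorner (k + 1) θ j = zeroCellCorner k θ j *
      if (θ (List.replicate k false)).1 = j then (θ (List.replicate k false)).2 else 1 := by
  simp [zeroCellCorner, Finset.prod_range_succ]

/-- The event that every cut on the leftmost path has its relative position in `[0,1]`; it has
full probability. -/
def ProperCuts (θ : List Bool → Fin d × ℝ) : Prop :=
  ∀ i : ℕ, (θ (List.replicate i false)).2 ∈ Set.Icc (0 : ℝ) 1

lemma zeroCellCorner_mem_Icc {θ : List Bool → Fin d × ℝ} (hθ : ProperCuts θ) (k : ℕ)
    (j : Fin d) : zeroCellCorner k θ j ∈ Set.Icc (0 : ℝ) 1 := by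
  constructor
  · refine Finset.prod_nonneg fun i _ => ?_
    split_ifs
    exacts [(hθ i).1, zero_le_one]
  · refine Finset.prod_le_one (fun i _ => ?_) fun i _ => ?_
    · split_ifs
      exacts [(hθ i).1, zero_le_one]
    · split_ifs
      exacts [(hθ i).2, le_rfl]

lemma update_zeroCellCorner (k : ℕ) (θ : List Bool → Fin d × ℝ) :
    Function.update (zeroCellCorner k θ) (θ (List.replicate k false)).1
      ((θ (List.replicate k false)).2 * zeroCellCorner k θ (θ (List.replicate k false)).1) =
    zeroCellCorner (k + 1) θ := by
  funext j
  rw [zeroCellCorner_succ]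
  by_cases h : (θ (List.replicate k false)).1 = j
  · subst h; simp [mul_comm]
  · simp [h, Function.update_of_ne (Ne.symm h)]

lemma nodeCell_zero {θ : List Bool → Fin d × ℝ} (hθ : ProperCuts θ) (k : ℕ) :
    nodeCell θ 0 k = ⟨List.replicate k false, fun _ => 0, zeroCellCorner k θ⟩ := by
  induction k with
  | zero => simp [nodeCell]; rfl
  | succ k ih =>
    have h : (0 : ℝ) ≤ (θ (List.replicate k false)).2 *
        zeroCellCorner k θ (θ (List.replicate k false)).1 :=
      mul_nonneg (hθ k).1 (zeroCellCorner_mem_Icc hθ k _).1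
    simp only [nodeCell, ih, Pi.zero_apply, zero_add, sub_zero]
    rw [if_pos h, update_zeroCellCorner, List.replicate_succ]

/-- A point of the cube shares the cell of the origin exactly when it lies below the upper corner
of that cell. -/
lemma nodeCell_node_eq_iff {θ : List Bool → Fin d × ℝ} (hθ : ProperCuts θ)
    {z : Fin d → ℝ} (hz : ∀ j, z j ≤ 1) (k : ℕ) :
    ((nodeCell θ z k).node = List.replicate k false ↔ ∀ j, z j ≤ zeroCellCorner k θ j) ∧
    ((nodeCell θ z k).node = List.replicate k false → nodeCell θ z k = nodeCell θ 0 k) := by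
  induction k with
  | zero => simp [nodeCell, zeroCellCorner, hz]
  | succ k ih =>
    set c := (θ (List.replicate k false)).1 with hc
    set u := (θ (List.replicate k false)).2 with hu
    have key : (∀ j, z j ≤ zeroCellCorner (k + 1) θ j) ↔
        (∀ j, z j ≤ zeroCellCorner k θ j) ∧ z c ≤ u * zeroCellCorner k θ c := by
      rw [← update_zeroCellCorner, ← hc, ← hu]
      constructor
      · intro h
        have h1 : z c ≤ u * zeroCellCorner k θ c := by simpa using h c
        refine ⟨fun j => ?_, h1⟩
        by_cases hj : j = c
        · subst hj
          exact h1.trans (mul_le_of_le_one_left (zeroCellCorner_mem_Icc hθ k _).1 (hθ k).2)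
        · simpa [Function.update_of_ne hj] using h j
      · rintro ⟨h1, h2⟩ j
        by_cases hj : j = c
        · subst hj; simpa using h2
        · simpa [Function.update_of_ne hj] using h1 j
    rw [key]
    by_cases hn : (nodeCell θ z k).node = List.replicate k false
    · have he := (ih.2 hn).trans (nodeCell_zero hθ k)
      have h0 : nodeCell θ 0 (k + 1) =
          ⟨List.replicate (k + 1) false, fun _ => 0, zeroCellCorner (k + 1) θ⟩ :=
        nodeCell_zero hθ (k + 1)
      rw [h0]
      simp only [nodeCell, he, zero_add, sub_zero, ← hc, ← hu, ← ih.1, true_and]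
      by_cases hle : z c ≤ u * zeroCellCorner k θ c
      · rw [if_pos hle]
        simpa [List.replicate_succ, hu, hc, update_zeroCellCorner] using hle
      · rw [if_neg hle]
        simp [hle, List.replicate_succ]
    · have : (nodeCell θ z (k + 1)).node ≠ List.replicate (k + 1) false := by
        simp only [nodeCell, List.replicate_succ]
        split_ifs <;> simp [hn]
      simp [this, ← ih.1, hn]

end Tree

/-! ### Moments of the cell of the origin -/

section Law

variable {d : ℕ} [NeZero d]

instance : IsProbabilityMeasure (volume.restrict (Set.Icc (0 : ℝ) 1)) := ⟨by simp⟩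

instance : IsProbabilityMeasure (treeLaw d) := by
  unfold treeLaw; infer_instance

lemma ae_properCuts : ∀ᵐ θ ∂treeLaw d, ProperCuts θ := by
  refine ae_all_iff.2 fun i => ?_
  have h : ∀ᵐ p ∂splitLaw d, p.2 ∈ Set.Icc (0 : ℝ) 1 :=
    Measure.quasiMeasurePreserving_snd.ae (ae_restrict_mem measurableSet_Icc)
  exact (measurePreserving_eval_infinitePi (fun _ : List Bool => splitLaw d)
    (List.replicate i false)).quasiMeasurePreserving.ae h

omit [NeZero d] in
@[fun_prop]
lemma measurable_zeroCellCorner (k : ℕ) (j : Fin d) :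
    Measurable fun θ => zeroCellCorner k θ j := by
  unfold zeroCellCorner
  refine Finset.measurable_prod _ fun i _ => ?_
  refine Measurable.ite ?_ (by fun_prop) (by fun_prop)
  exact (measurable_fst.comp (measurable_pi_apply (List.replicate i false)))
    (measurableSet_singleton j)

/-- On the cube, the kernel at the origin is the probability that a point is dominated by the
corner of the cell of the origin. -/
lemma uniformKernel_zero {z : Fin d → ℝ} (hz : ∀ j, z j ≤ 1) (k : ℕ) :
    uniformKernel d k 0 z = (treeLaw d).real {θ | ∀ j, z j ≤ zeroCellCorner k θ j} := by
  refine measureReal_congr ?_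
  filter_upwards [ae_properCuts (d := d)] with θ hθ
  refine propext ?_
  change (nodeCell θ 0 k).node = (nodeCell θ z k).node ↔ ∀ j, z j ≤ zeroCellCorner k θ j
  rw [← (nodeCell_node_eq_iff hθ hz k).1, nodeCell_zero hθ k, eq_comm]

lemma integral_splitLaw (f : Fin d → ℝ → ℝ) (hf : ∀ c, Continuous (f c)) :
    ∫ p, f p.1 p.2 ∂splitLaw d = (d : ℝ)⁻¹ * ∑ c, ∫ u in (0 : ℝ)..1, f c u := by
  have hm : Measurable fun p : Fin d × ℝ => f p.1 p.2 :=
    measurable_from_prod_countable_right fun c => (hf c).measurable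
  have hI : Integrable (fun p : Fin d × ℝ => f p.1 p.2) (splitLaw d) := by
    refine (integrable_prod_iff hm.aestronglyMeasurable).2
      ⟨.of_forall fun c => (hf c).continuousOn.integrableOn_Icc, .of_finite⟩
  unfold splitLaw at hI ⊢
  rw [integral_prod _ hI, PMF.integral_eq_sum, Finset.mul_sum]
  refine Finset.sum_congr rfl fun c _ => ?_
  rw [intervalIntegral.integral_of_le zero_le_one, integral_Icc_eq_integral_Ioc]
  simp

/-- Products of functions of the splits on the leftmost path have product expectations. -/
lemma integral_prod_leftmost (k : ℕ) (f : Fin d × ℝ → ℝ) (hf : Measurable f) :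
    ∫ θ, ∏ i ∈ Finset.range k, f (θ (List.replicate i false)) ∂treeLaw d =
      (∫ p, f p ∂splitLaw d) ^ k := by
  have hinj : Function.Injective fun i : Fin k => List.replicate (i : ℕ) false := fun a b h => by
    simpa [Fin.ext_iff] using congrArg List.length h
  have hi : iIndepFun (fun (b : List Bool) (θ : List Bool → Fin d × ℝ) => f (θ b)) (treeLaw d) :=
    iIndepFun_infinitePi fun _ => hf
  have h := (hi.precomp hinj).integral_fun_prod_eq_prod_integral
    fun i => (hf.comp (measurable_pi_apply _)).aestronglyMeasurable
  simp_rw [Finset.prod_range]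
  refine h.trans ?_
  have h2 (b : List Bool) : ∫ θ, f (θ b) ∂treeLaw d = ∫ p, f p ∂splitLaw d := by
    rw [← (measurePreserving_eval_infinitePi (fun _ : List Bool => splitLaw d) b).map_eq,
      integral_map (measurable_pi_apply b).aemeasurable hf.aestronglyMeasurable]
    rfl
  simp [h2]

omit [NeZero d] in
/-- The volume of the cell of the origin: every split contributes one factor. -/
lemma prod_zeroCellCorner (k : ℕ) (θ : List Bool → Fin d × ℝ) :
    ∏ j, zeroCellCorner k θ j = ∏ i ∈ Finset.range k, (θ (List.replicate i false)).2 := by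
  unfold zeroCellCorner
  rw [Finset.prod_comm]
  simp

/-- The mean volume of the cell of the origin. -/
lemma integral_prod_zeroCellCorner (k : ℕ) :
    ∫ θ, ∏ j, zeroCellCorner k θ j ∂treeLaw d = (1 / 2) ^ k := by
  simp_rw [prod_zeroCellCorner]
  rw [integral_prod_leftmost k (fun p => p.2) measurable_snd,
    integral_splitLaw (fun _ u => u) fun _ => continuous_id]
  have : (d : ℝ) ≠ 0 := NeZero.ne _
  simp [integral_id, this]

/-- The mean of the volume of the cell of the origin times one of its side lengths. A split in
another coordinate contributes the mean `1/2` of the cut, a split in this one the mean `1/3` of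
its square. -/
lemma integral_zeroCellCorner_mul_prod (k : ℕ) (l : Fin d) :
    ∫ θ, zeroCellCorner k θ l * ∏ j, zeroCellCorner k θ j ∂treeLaw d =
      ((1 - 1 / (3 * (d : ℝ))) / 2) ^ k := by
  simp_rw [prod_zeroCellCorner]
  unfold zeroCellCorner
  simp_rw [← Finset.prod_mul_distrib]
  have hc (c : Fin d) : Continuous fun u : ℝ => (if c = l then u else 1) * u := by
    split_ifs <;> fun_prop
  rw [integral_prod_leftmost k (fun p => (if p.1 = l then p.2 else 1) * p.2)
      (measurable_from_prod_countable_right fun c => (hc c).measurable),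
    integral_splitLaw (fun c u => (if c = l then u else 1) * u) hc]
  have h (c : Fin d) : ∫ u in (0 : ℝ)..1, (if c = l then u else 1) * u =
      1 / 2 - if c = l then 1 / 6 else 0 := by
    split_ifs
    · have : ∫ u in (0 : ℝ)..1, u * u = 1 / 3 := by
        simp_rw [← pow_two]; rw [integral_pow]; norm_num
      rw [this]; norm_num
    · simp [integral_id]
  have : (d : ℝ) ≠ 0 := NeZero.ne _
  congr 1
  simp_rw [h, Finset.sum_sub_distrib]
  simp
  field_simp
  ring

end Law

/-! ### Averages of the kernel over the cube -/

/-- The uniform law on the cube `[0,1]^d`. -/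
noncomputable abbrev cubeLaw (d : ℕ) : Measure (Fin d → ℝ) :=
  volume.restrict (Set.Icc (0 : Fin d → ℝ) 1)

/-- The translated kernel `y ↦ K(0, |y - x|)`, written through the corner of the cell of the
origin. It is defined for all `y`, and agrees with the kernel when `x` and `y` are in the cube. -/
noncomputable def shiftKernel (d : ℕ) [NeZero d] (k : ℕ) (x y : Fin d → ℝ) : ℝ :=
  (treeLaw d).real {θ | ∀ j, |y j - x j| ≤ zeroCellCorner k θ j}

/-- The `ℓ¹` distance, with the coordinates truncated at `1`; the truncation makes it bounded and
changes nothing on the cube. -/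
noncomputable def truncDist {d : ℕ} (x y : Fin d → ℝ) : ℝ := ∑ j, min |y j - x j| 1

section Kernel

variable {d : ℕ}

lemma volume_cube : volume (Set.Icc (0 : Fin d → ℝ) 1) = 1 := by
  simp [Real.volume_Icc_pi]

instance : IsProbabilityMeasure (cubeLaw d) := ⟨by simp [volume_cube]⟩

lemma truncDist_nonneg (x y : Fin d → ℝ) : 0 ≤ truncDist x y :=
  Finset.sum_nonneg fun _ _ => le_min (abs_nonneg _) zero_le_one

lemma truncDist_le (x y : Fin d → ℝ) : truncDist x y ≤ d := by
  refine (Finset.sum_le_sum fun j _ => min_le_right |y j - x j| 1).trans ?_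
  simp

lemma measurable_truncDist (x : Fin d → ℝ) : Measurable (truncDist x) := by
  unfold truncDist
  fun_prop

lemma abs_sub_le_one_of_mem_cube {x y : Fin d → ℝ} (hx : x ∈ Set.Icc (0 : Fin d → ℝ) 1)
    (hy : y ∈ Set.Icc (0 : Fin d → ℝ) 1) (j : Fin d) : |y j - x j| ≤ 1 := by
  have h1 := hx.1 j
  have h2 := hx.2 j
  have h3 := hy.1 j
  have h4 := hy.2 j
  simp only [Pi.zero_apply, Pi.one_apply] at h1 h2 h3 h4
  exact abs_le.2 ⟨by linarith, by linarith⟩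

/-- The part of the cube within coordinatewise distance `h` of one of its points is a box whose
side lengths are between `h j` and `2 * h j`. -/
lemma cubeLaw_box_bounds {x h : Fin d → ℝ} (hx : x ∈ Set.Icc (0 : Fin d → ℝ) 1)
    (hh : ∀ j, h j ∈ Set.Icc (0 : ℝ) 1) :
    ∏ j, h j ≤ (cubeLaw d).real {y | ∀ j, |y j - x j| ≤ h j} ∧
      (cubeLaw d).real {y | ∀ j, |y j - x j| ≤ h j} ≤ 2 ^ d * ∏ j, h j := by
  have hx0 (j) : 0 ≤ x j := hx.1 j
  have hx1 (j) : x j ≤ 1 := hx.2 j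
  have hset : Set.Icc (0 : Fin d → ℝ) 1 ∩ {y | ∀ j, |y j - x j| ≤ h j} =
      Set.Icc (fun j => max 0 (x j - h j)) (fun j => min 1 (x j + h j)) := by
    ext y
    simp only [Set.mem_inter_iff, Set.mem_Icc, Pi.le_def, Set.mem_ofPred_eq, abs_le,
      Pi.zero_apply, Pi.one_apply, max_le_iff, le_min_iff, ← forall_and]
    refine forall_congr' fun j => ?_
    constructor
    · rintro ⟨⟨_, _⟩, _, _⟩
      refine ⟨⟨?_, ?_⟩, ?_, ?_⟩ <;> linarith
    · rintro ⟨⟨_, _⟩, _, _⟩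
      refine ⟨⟨?_, ?_⟩, ?_, ?_⟩ <;> linarith
  have hle : (fun j => max 0 (x j - h j)) ≤ fun j => min 1 (x j + h j) := fun j => by
    have := hx0 j; have := hx1 j; have := (hh j).1
    exact max_le (le_min zero_le_one (by linarith)) (le_min (by linarith) (by linarith))
  have hms : MeasurableSet {y : Fin d → ℝ | ∀ j, |y j - x j| ≤ h j} := by
    rw [Set.ofPred_forall]
    exact MeasurableSet.iInter fun j => measurableSet_le (by fun_prop) (by fun_prop)
  have hv : (cubeLaw d).real {y | ∀ j, |y j - x j| ≤ h j} =
      ∏ j, (min 1 (x j + h j) - max 0 (x j - h j)) := by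
    rw [measureReal_restrict_apply hms, Set.inter_comm, hset, measureReal_def,
      Real.volume_Icc_pi_toReal hle]
  have hside (j) : h j ≤ min 1 (x j + h j) - max 0 (x j - h j) ∧
      min 1 (x j + h j) - max 0 (x j - h j) ≤ 2 * h j := by
    have := hx0 j; have := hx1 j; have := (hh j).1; have := (hh j).2
    constructor
    · rcases min_cases 1 (x j + h j) with h1 | h1 <;> rcases max_cases 0 (x j - h j) with h2 | h2 <;>
        linarith
    · linarith [min_le_right 1 (x j + h j), le_max_right 0 (x j - h j)]
  rw [hv]
  constructor
  · exact Finset.prod_le_prod (fun j _ => (hh j).1) fun j _ => (hside j).1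
  · calc _ ≤ ∏ j, 2 * h j :=
          Finset.prod_le_prod (fun j _ => (hh j).1.trans (hside j).1) fun j _ => (hside j).2
      _ = _ := by simp [Finset.prod_mul_distrib]

variable [NeZero d]

lemma uniformKernel_eq_shiftKernel {x y : Fin d → ℝ} (hx : x ∈ Set.Icc (0 : Fin d → ℝ) 1)
    (hy : y ∈ Set.Icc (0 : Fin d → ℝ) 1) (k : ℕ) :
    uniformKernel d k 0 (fun j => |y j - x j|) = shiftKernel d k x y :=
  uniformKernel_zero (fun j => abs_sub_le_one_of_mem_cube hx hy j) k

lemma shiftKernel_nonneg (k : ℕ) (x y : Fin d → ℝ) : 0 ≤ shiftKernel d k x y :=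
  measureReal_nonneg

lemma shiftKernel_le_one (k : ℕ) (x y : Fin d → ℝ) : shiftKernel d k x y ≤ 1 :=
  measureReal_le_one

omit [NeZero d] in
lemma measurableSet_shift (k : ℕ) (x : Fin d → ℝ) :
    MeasurableSet {p : (Fin d → ℝ) × (List Bool → Fin d × ℝ) |
      ∀ j, |p.1 j - x j| ≤ zeroCellCorner k p.2 j} := by
  rw [Set.ofPred_forall]
  refine MeasurableSet.iInter fun j => measurableSet_le (by fun_prop) ?_
  exact (measurable_zeroCellCorner k j).comp measurable_snd

lemma measurable_shiftKernel (k : ℕ) (x : Fin d → ℝ) : Measurable (shiftKernel d k x) :=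
  (measurable_measure_prodMk_left (measurableSet_shift k x)).ennreal_toReal

/-- Averages against the translated kernel are averages over the tree of integrals over the
translated cell of the origin. -/
lemma integral_mul_shiftKernel (k : ℕ) (x : Fin d → ℝ) {f : (Fin d → ℝ) → ℝ}
    (hf : Measurable f) {c : ℝ} (hc : ∀ y, |f y| ≤ c) :
    ∫ y, f y * shiftKernel d k x y ∂cubeLaw d =
      ∫ θ, (∫ y in {y | ∀ j, |y j - x j| ≤ zeroCellCorner k θ j}, f y ∂cubeLaw d) ∂treeLaw d := by
  set S := {p : (Fin d → ℝ) × (List Bool → Fin d × ℝ) |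
      ∀ j, |p.1 j - x j| ≤ zeroCellCorner k p.2 j} with hSdef
  have hS : MeasurableSet S := measurableSet_shift k x
  have hI : Integrable (S.indicator fun p => f p.1) ((cubeLaw d).prod (treeLaw d)) := by
    refine Integrable.indicator ?_ hS
    exact Integrable.of_bound (hf.comp measurable_fst).aestronglyMeasurable c
      (.of_forall fun p => hc p.1)
  have h := integral_integral_swap (f := fun y θ => S.indicator (fun p => f p.1) (y, θ)) hI
  refine Eq.trans (integral_congr_ae (.of_forall fun y => ?_))
    (h.trans (integral_congr_ae (.of_forall fun θ => ?_)))
  · have hm : MeasurableSet (Prod.mk y ⁻¹' S) := measurable_prodMk_left hS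
    have : (fun θ => S.indicator (fun p => f p.1) (y, θ)) =
        (Prod.mk y ⁻¹' S).indicator fun _ => f y := rfl
    simp only [this]
    rw [integral_indicator_const _ hm, smul_eq_mul, mul_comm]
    rfl
  · have hm : MeasurableSet ((fun y => (y, θ)) ⁻¹' S) := measurable_prodMk_right hS
    have : (fun y => S.indicator (fun p => f p.1) (y, θ)) =
        ((fun y => (y, θ)) ⁻¹' S).indicator f := rfl
    simp only [this]
    rw [integral_indicator hm]
    rfl

lemma integrable_of_measurable_bounded {α : Type*} {_ : MeasurableSpace α} {μ : Measure α}
    [IsFiniteMeasure μ] {f : α → ℝ} (hf : Measurable f) {c : ℝ} (hc : ∀ y, |f y| ≤ c) :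
    Integrable f μ :=
  Integrable.of_bound hf.aestronglyMeasurable c (.of_forall hc)

lemma integrable_corner_mul_prod (k : ℕ) (l : Fin d) :
    Integrable (fun θ => zeroCellCorner k θ l * ∏ j, zeroCellCorner k θ j) (treeLaw d) := by
  have h := measurable_zeroCellCorner (d := d) k
  refine Integrable.of_bound (by fun_prop) 1 ?_
  filter_upwards [ae_properCuts (d := d)] with θ hθ
  have hl := zeroCellCorner_mem_Icc hθ k
  have h0 : 0 ≤ ∏ j, zeroCellCorner k θ j := Finset.prod_nonneg fun j _ => (hl j).1
  rw [Real.norm_of_nonneg (mul_nonneg (hl l).1 h0)]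
  exact mul_le_one₀ (hl l).2 h0 (Finset.prod_le_one (fun j _ => (hl j).1) fun j _ => (hl j).2)

/-- The translated kernel has mean at least `2^{-k}`. -/
lemma le_integral_shiftKernel (k : ℕ) {x : Fin d → ℝ} (hx : x ∈ Set.Icc (0 : Fin d → ℝ) 1) :
    (1 / 2) ^ k ≤ ∫ y, shiftKernel d k x y ∂cubeLaw d := by
  have h := integral_mul_shiftKernel k x (f := fun _ => 1) measurable_const (c := 1) (by simp)
  simp only [one_mul] at h
  rw [h, ← integral_prod_zeroCellCorner (d := d) k]
  simp only [integral_const, smul_eq_mul, mul_one, measureReal_restrict_apply_univ]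
  refine integral_mono_of_nonneg ?_ ?_ ?_
  · filter_upwards [ae_properCuts (d := d)] with θ hθ
    exact Finset.prod_nonneg fun j _ => (zeroCellCorner_mem_Icc hθ k j).1
  · refine integrable_of_measurable_bounded (c := 1) ?_ ?_
    · exact (measurable_measure_prodMk_right (measurableSet_shift k x)).ennreal_toReal
    · intro θ
      rw [abs_of_nonneg measureReal_nonneg]
      exact measureReal_le_one
  · filter_upwards [ae_properCuts (d := d)] with θ hθ
    exact (cubeLaw_box_bounds hx (zeroCellCorner_mem_Icc hθ k)).1

/-- The first moment of the translated kernel, the source of the bias bound. -/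
lemma integral_truncDist_mul_shiftKernel_le (k : ℕ) {x : Fin d → ℝ}
    (hx : x ∈ Set.Icc (0 : Fin d → ℝ) 1) :
    ∫ y, truncDist x y * shiftKernel d k x y ∂cubeLaw d ≤
      d * 2 ^ d * ((1 - 1 / (3 * (d : ℝ))) / 2) ^ k := by
  have hD : ∀ y, |truncDist x y| ≤ d := fun y => by
    rw [abs_of_nonneg (truncDist_nonneg x y)]; exact truncDist_le x y
  rw [integral_mul_shiftKernel k x (measurable_truncDist x) hD]
  calc _ ≤ ∫ θ, ∑ l, 2 ^ d * (zeroCellCorner k θ l * ∏ j, zeroCellCorner k θ j) ∂treeLaw d := by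
        refine integral_mono_of_nonneg
          (.of_forall fun θ => integral_nonneg fun y => truncDist_nonneg x y) ?_ ?_
        · exact integrable_finsetSum _ fun l _ => (integrable_corner_mul_prod k l).const_mul _
        filter_upwards [ae_properCuts (d := d)] with θ hθ
        have hl := zeroCellCorner_mem_Icc hθ k
        have hb := (cubeLaw_box_bounds hx hl).2
        set A := {y : Fin d → ℝ | ∀ j, |y j - x j| ≤ zeroCellCorner k θ j} with hA
        have hAm : MeasurableSet A := measurable_prodMk_right (measurableSet_shift k x)
        calc ∫ y in A, truncDist x y ∂cubeLaw d
            ≤ ∫ y in A, ∑ l, zeroCellCorner k θ l ∂cubeLaw d := by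
              refine setIntegral_mono_on
                (integrable_of_measurable_bounded (measurable_truncDist x) hD).integrableOn
                (integrable_const _).integrableOn hAm fun y hy => ?_
              exact Finset.sum_le_sum fun l _ => (min_le_left _ _).trans (hy l)
          _ = (cubeLaw d).real A * ∑ l, zeroCellCorner k θ l := by simp
          _ ≤ (2 ^ d * ∏ j, zeroCellCorner k θ j) * ∑ l, zeroCellCorner k θ l :=
              mul_le_mul_of_nonneg_right hb (Finset.sum_nonneg fun l _ => (hl l).1)
          _ = _ := by
              rw [Finset.mul_sum]
              exact Finset.sum_congr rfl fun l _ => by ring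
    _ = _ := by
        rw [integral_finsetSum _ fun l _ => (integrable_corner_mul_prod k l).const_mul _]
        simp_rw [integral_const_mul, integral_zeroCellCorner_mul_prod]
        simp
        ring

end Kernel

/-! ### Sums of independent copies -/

section IidSums

lemma abs_sum_comp_le {E : Type*} {n : ℕ} {f : E → ℝ} {c : ℝ} (hc : ∀ y, |f y| ≤ c)
    (X : Fin n → E) : |∑ i, f (X i)| ≤ n * c :=
  (Finset.abs_sum_le_sum_abs _ _).trans
    ((Finset.sum_le_sum fun i _ => hc (X i)).trans (by simp))

variable {E : Type*} [MeasurableSpace E] {U : Measure E} [IsProbabilityMeasure U] {n : ℕ}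

lemma measurable_sum_comp {f : E → ℝ} (hf : Measurable f) :
    Measurable fun X : Fin n → E => ∑ i, f (X i) :=
  Finset.measurable_fun_sum _ fun i _ => hf.comp (measurable_pi_apply i)

lemma integral_sum_pi {f : E → ℝ} (hf : Measurable f) {c : ℝ} (hc : ∀ y, |f y| ≤ c) :
    ∫ X, ∑ i, f (X i) ∂Measure.pi (fun _ : Fin n => U) = n * ∫ y, f y ∂U := by
  have hI (i : Fin n) : Integrable (fun X : Fin n → E => f (X i))
      (Measure.pi fun _ : Fin n => U) :=
    integrable_of_measurable_bounded (hf.comp (measurable_pi_apply i)) fun X => hc (X i)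
  rw [integral_finsetSum _ fun i _ => hI i]
  have h (i : Fin n) : ∫ X, f (X i) ∂Measure.pi (fun _ : Fin n => U) = ∫ y, f y ∂U := by
    conv_rhs => rw [← (measurePreserving_eval (fun _ : Fin n => U) i).map_eq]
    rw [integral_map (measurable_pi_apply i).aemeasurable hf.aestronglyMeasurable]
  simp [h]

lemma variance_sum_iid_le {f : E → ℝ} (hf : Measurable f) {c : ℝ} (hc : ∀ y, |f y| ≤ c) :
    Var[fun X => ∑ i, f (X i); Measure.pi (fun _ : Fin n => U)] ≤ n * ∫ y, f y ^ 2 ∂U := by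
  have hL : MemLp f 2 U := MemLp.of_bound hf.aestronglyMeasurable c (.of_forall hc)
  have h := variance_sum_pi (ι := Fin n) (μ := fun _ => U) (X := fun _ => f) fun _ => hL
  have h2 : (fun X : Fin n → E => ∑ i, f (X i)) = ∑ i, fun X : Fin n → E => f (X i) := by
    ext X; simp
  rw [h2, h]
  simp only [Finset.sum_const, Finset.card_univ, Fintype.card_fin, nsmul_eq_mul]
  gcongr
  exact variance_le_expectation_sq hf.aestronglyMeasurable

/-- Chebyshev's second moment for a sum of independent copies. -/
lemma integral_sum_sub_sq_le {f : E → ℝ} (hf : Measurable f) {c : ℝ} (hc : ∀ y, |f y| ≤ c) :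
    ∫ X, (∑ i, f (X i) - n * ∫ y, f y ∂U) ^ 2 ∂Measure.pi (fun _ : Fin n => U) ≤
      n * ∫ y, f y ^ 2 ∂U := by
  refine le_trans (le_of_eq ?_) (variance_sum_iid_le (n := n) hf hc)
  rw [variance_eq_integral (measurable_sum_comp hf).aemeasurable, integral_sum_pi hf hc]

lemma integral_sum_sq_le {f : E → ℝ} (hf : Measurable f) {c : ℝ} (hc : ∀ y, |f y| ≤ c) :
    ∫ X, (∑ i, f (X i)) ^ 2 ∂Measure.pi (fun _ : Fin n => U) ≤
      n * ∫ y, f y ^ 2 ∂U + (n * ∫ y, f y ∂U) ^ 2 := by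
  have h := variance_sum_iid_le (U := U) (n := n) hf hc
  rw [variance_eq_sub (MemLp.of_bound (measurable_sum_comp hf).aestronglyMeasurable (n * c)
    (.of_forall (abs_sum_comp_le hc))), integral_sum_pi hf hc] at h
  simp only [Pi.pow_apply] at h
  linarith

end IidSums

/-! ### Gaussian noise -/

section Noise

variable {n : ℕ}

/-- A linear form in independent centred Gaussians has second moment given by its coefficients. -/
lemma integral_affine_gaussian_sq (v : ℝ≥0) (b : ℝ) (a : Fin n → ℝ) :
    Integrable (fun e => (b + ∑ i, a i * e i) ^ 2)
        (Measure.pi fun _ : Fin n => gaussianReal 0 v) ∧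
      ∫ e, (b + ∑ i, a i * e i) ^ 2 ∂(Measure.pi fun _ : Fin n => gaussianReal 0 v) =
        b ^ 2 + v * ∑ i, a i ^ 2 := by
  have hid : MemLp (fun x : ℝ => x) 2 (gaussianReal 0 v) := memLp_id_gaussianReal 2
  have h1 (i : Fin n) : MemLp (fun x : ℝ => a i * x) 2 (gaussianReal 0 v) := hid.const_mul _
  have hpi (i : Fin n) : MemLp (fun e : Fin n → ℝ => a i * e i) 2
      (Measure.pi fun _ : Fin n => gaussianReal 0 v) :=
    (h1 i).comp_measurePreserving (measurePreserving_eval (fun _ : Fin n => gaussianReal 0 v) i)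
  have hsum : MemLp (fun e : Fin n → ℝ => ∑ i, a i * e i) 2
      (Measure.pi fun _ : Fin n => gaussianReal 0 v) := memLp_finsetSum _ fun i _ => hpi i
  have hmem : MemLp (fun e : Fin n → ℝ => b + ∑ i, a i * e i) 2
      (Measure.pi fun _ : Fin n => gaussianReal 0 v) := (memLp_const b).add hsum
  have hmean0 (i : Fin n) :
      ∫ e : Fin n → ℝ, a i * e i ∂(Measure.pi fun _ : Fin n => gaussianReal 0 v) = 0 := by
    have h : ∫ x, a i * x ∂(Measure.pi fun _ : Fin n => gaussianReal 0 v).map (Function.eval i) =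
        0 := by
      rw [(measurePreserving_eval (fun _ : Fin n => gaussianReal 0 v) i).map_eq,
        integral_const_mul, integral_id_gaussianReal, mul_zero]
    rwa [integral_map (measurable_pi_apply i).aemeasurable (by fun_prop)] at h
  have hmean : ∫ e : Fin n → ℝ, (b + ∑ i, a i * e i)
      ∂(Measure.pi fun _ : Fin n => gaussianReal 0 v) = b := by
    rw [integral_add (integrable_const _) (hsum.integrable one_le_two),
      integral_finsetSum _ fun i _ => (hpi i).integrable one_le_two]
    simp [hmean0]
  have hvar : Var[fun e : Fin n → ℝ => b + ∑ i, a i * e i;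
      Measure.pi fun _ : Fin n => gaussianReal 0 v] = v * ∑ i, a i ^ 2 := by
    rw [variance_const_add hsum.aestronglyMeasurable]
    have h := variance_sum_pi (ι := Fin n) (μ := fun _ => gaussianReal 0 v)
      (X := fun i x => a i * x) h1
    have h2 : (fun e : Fin n → ℝ => ∑ i, a i * e i) = ∑ i, fun e : Fin n → ℝ => a i * e i := by
      ext X; simp
    rw [h2, h, Finset.mul_sum]
    refine Finset.sum_congr rfl fun i _ => ?_
    rw [variance_const_mul, variance_fun_id_gaussianReal]
    ring
  refine ⟨hmem.integrable_sq, ?_⟩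
  rw [variance_eq_sub hmem, hmean] at hvar
  simp only [Pi.pow_apply] at hvar
  linarith

end Noise

/-! ### Risk of kernel regression estimates -/

section KernelRegression

variable {E : Type*} {n : ℕ}

/-- The error at a point where the regression function has the value `c`, for the kernel regression
estimate with weights `W` on the sample `(X i, f (X i) + e i)`. -/
noncomputable def kernelError (W f : E → ℝ) (c : ℝ) (X : Fin n → E) (e : Fin n → ℝ) : ℝ :=
  (∑ i, (f (X i) + e i) * W (X i)) / ∑ i, W (X i) - c

/-- The mean over the noise of the square of the error: squared bias plus variance. -/
noncomputable def noiseRisk (W f : E → ℝ) (c : ℝ) (v : ℝ≥0) (X : Fin n → E) : ℝ :=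
  ((∑ i, f (X i) * W (X i)) / ∑ i, W (X i) - c) ^ 2 +
    v * ∑ i, (W (X i) / ∑ i, W (X i)) ^ 2

lemma kernelError_eq (W f : E → ℝ) (c : ℝ) (X : Fin n → E) (e : Fin n → ℝ) :
    kernelError W f c X e = ((∑ i, f (X i) * W (X i)) / ∑ i, W (X i) - c) +
      ∑ i, (W (X i) / ∑ i, W (X i)) * e i := by
  have : ∑ i, (W (X i) / ∑ i, W (X i)) * e i = (∑ i, e i * W (X i)) / ∑ i, W (X i) := by
    rw [Finset.sum_div]
    exact Finset.sum_congr rfl fun i _ => by ring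
  rw [this, kernelError]
  simp only [add_mul, Finset.sum_add_distrib]
  ring

section Bounds

variable {W D f : E → ℝ} {c M B : ℝ} (hW0 : ∀ y, 0 ≤ W y) (hW1 : ∀ y, W y ≤ 1)
  (hfD : ∀ y, |f y - c| ≤ M * D y) (hMD : ∀ y, M * D y ≤ B) (hcB : |c| ≤ B)

lemma bias_eq {X : Fin n → E} (hS : 0 < ∑ i, W (X i)) :
    (∑ i, f (X i) * W (X i)) / ∑ i, W (X i) - c =
      (∑ i, (f (X i) - c) * W (X i)) / ∑ i, W (X i) := by
  simp only [sub_mul, Finset.sum_sub_distrib, ← Finset.mul_sum]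
  field_simp

include hW0 hfD in
lemma abs_bias_le {X : Fin n → E} (hS : 0 < ∑ i, W (X i)) :
    |(∑ i, f (X i) * W (X i)) / ∑ i, W (X i) - c| ≤
      M * (∑ i, D (X i) * W (X i)) / ∑ i, W (X i) := by
  rw [bias_eq hS, abs_div, abs_of_pos hS, Finset.mul_sum]
  gcongr
  refine (Finset.abs_sum_le_sum_abs _ _).trans (Finset.sum_le_sum fun i _ => ?_)
  rw [abs_mul, abs_of_nonneg (hW0 _), ← mul_assoc]
  exact mul_le_mul_of_nonneg_right (hfD _) (hW0 _)

include hW0 hfD hMD hcB in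
/-- The weights of the estimate form a (sub)probability vector, which bounds the risk whatever
the sample. When all weights vanish, the estimate is `0` and the error is the value `c` itself. -/
lemma noiseRisk_le (v : ℝ≥0) (X : Fin n → E) : noiseRisk W f c v X ≤ B ^ 2 + v := by
  have hS0 : 0 ≤ ∑ i, W (X i) := Finset.sum_nonneg fun i _ => hW0 _
  rcases hS0.eq_or_lt with hS | hS
  · simp only [noiseRisk, ← hS, div_zero, zero_sub, neg_sq]
    have : c ^ 2 ≤ B ^ 2 := sq_le_sq' (by linarith [neg_abs_le c]) ((le_abs_self c).trans hcB)
    simpa using this.trans (le_add_of_nonneg_right v.coe_nonneg)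
  · refine add_le_add ?_ (mul_le_of_le_one_right v.coe_nonneg ?_)
    · rw [← sq_abs]
      refine pow_le_pow_left₀ (abs_nonneg _) ((abs_bias_le hW0 hfD hS).trans ?_) 2
      rw [div_le_iff₀ hS, Finset.mul_sum, Finset.mul_sum]
      refine Finset.sum_le_sum fun i _ => ?_
      rw [← mul_assoc]
      exact mul_le_mul_of_nonneg_right (hMD _) (hW0 _)
    · have h1 : ∑ i, W (X i) / ∑ i, W (X i) = 1 := by
        rw [← Finset.sum_div, div_self hS.ne']
      rw [← h1]
      refine Finset.sum_le_sum fun i _ => ?_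
      have h2 : W (X i) / ∑ i, W (X i) ≤ 1 := by
        rw [div_le_one hS]
        exact Finset.single_le_sum (f := fun i => W (X i)) (fun i _ => hW0 _) (Finset.mem_univ i)
      exact pow_le_of_le_one (div_nonneg (hW0 _) hS.le) h2 two_ne_zero

include hW0 hW1 hfD hMD hcB in
/-- The pointwise form of the risk bound. Where the total weight `S` is at least half its mean
`t`, numerators and denominator are compared separately; elsewhere the crude bound is paid for by
the deviation of `S`, which is at least `t / 2`. -/
lemma noiseRisk_le_of_mean (v : ℝ≥0) {t : ℝ} (ht : 0 < t) (X : Fin n → E) :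
    noiseRisk W f c v X ≤ 4 / t ^ 2 * (M ^ 2 * (∑ i, D (X i) * W (X i)) ^ 2 +
      v * ∑ i, W (X i) + (B ^ 2 + v) * (∑ i, W (X i) - t) ^ 2) := by
  set S := ∑ i, W (X i) with hSdef
  set R := ∑ i, D (X i) * W (X i) with hRdef
  have hS0 : 0 ≤ S := Finset.sum_nonneg fun i _ => hW0 _
  have hv := v.coe_nonneg
  have h4 : 0 < 4 / t ^ 2 := by positivity
  rcases lt_or_ge S (t / 2) with hlt | hge
  · have h1 : 1 ≤ 4 / t ^ 2 * (S - t) ^ 2 := by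
      rw [div_mul_eq_mul_div, one_le_div (by positivity)]
      nlinarith
    calc noiseRisk W f c v X ≤ B ^ 2 + v := noiseRisk_le hW0 hfD hMD hcB v X
      _ ≤ (B ^ 2 + v) * (4 / t ^ 2 * (S - t) ^ 2) := le_mul_of_one_le_right (by positivity) h1
      _ = 4 / t ^ 2 * ((B ^ 2 + v) * (S - t) ^ 2) := by ring
      _ ≤ _ := by
        gcongr
        linarith [mul_nonneg hv hS0, mul_nonneg (sq_nonneg M) (sq_nonneg R)]
  · have hS : 0 < S := by linarith
    have hinv : 1 / S ^ 2 ≤ 4 / t ^ 2 := by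
      rw [div_le_div_iff₀ (by positivity) (by positivity)]
      nlinarith
    have hb : ((∑ i, f (X i) * W (X i)) / S - c) ^ 2 ≤ 4 / t ^ 2 * (M ^ 2 * R ^ 2) := by
      rw [← sq_abs]
      calc _ ≤ (M * R / S) ^ 2 := pow_le_pow_left₀ (abs_nonneg _) (abs_bias_le hW0 hfD hS) 2
        _ = 1 / S ^ 2 * (M ^ 2 * R ^ 2) := by ring
        _ ≤ _ := by gcongr
    have ha : ∑ i, (W (X i) / S) ^ 2 ≤ 4 / t ^ 2 * S := by
      calc _ = 1 / S ^ 2 * ∑ i, W (X i) ^ 2 := by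
            rw [Finset.mul_sum]
            exact Finset.sum_congr rfl fun i _ => by ring
        _ ≤ 4 / t ^ 2 * S := by
            refine mul_le_mul hinv (Finset.sum_le_sum fun i _ => ?_)
              (Finset.sum_nonneg fun i _ => sq_nonneg _) h4.le
            exact pow_le_of_le_one (hW0 _) (hW1 _) two_ne_zero
    calc noiseRisk W f c v X ≤ 4 / t ^ 2 * (M ^ 2 * R ^ 2) + v * (4 / t ^ 2 * S) :=
          add_le_add hb (mul_le_mul_of_nonneg_left ha hv)
      _ = 4 / t ^ 2 * (M ^ 2 * R ^ 2 + v * S) := by ring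
      _ ≤ _ := by
        refine mul_le_mul_of_nonneg_left ?_ h4.le
        linarith [mul_nonneg (add_nonneg (sq_nonneg B) hv) (sq_nonneg (S - t))]

end Bounds

variable [MeasurableSpace E] {U : Measure E} [IsProbabilityMeasure U]

lemma measurable_noiseRisk {W f : E → ℝ} (hW : Measurable W) (hf : Measurable f) (c : ℝ)
    (v : ℝ≥0) : Measurable (noiseRisk (n := n) W f c v) := by
  unfold noiseRisk
  fun_prop

lemma measurable_kernelError {W f : E → ℝ} (hW : Measurable W) (hf : Measurable f) (c : ℝ) :
    Measurable fun p : (Fin n → E) × (Fin n → ℝ) => kernelError W f c p.1 p.2 := by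
  unfold kernelError
  fun_prop

/-- Averaging the risk over the sample: a variance term of order `1 / (n p)`, with `p` the mean
weight, and the squared bias `(q / p) ^ 2`, with `q` the mean of the weighted distance. -/
lemma integral_noiseRisk_le {W D f : E → ℝ} {c M B d p q : ℝ} (hn : 0 < n)
    (hW0 : ∀ y, 0 ≤ W y) (hW1 : ∀ y, W y ≤ 1) (hD0 : ∀ y, 0 ≤ D y) (hDd : ∀ y, D y ≤ d)
    (hfD : ∀ y, |f y - c| ≤ M * D y) (hMD : ∀ y, M * D y ≤ B) (hcB : |c| ≤ B)
    (hW : Measurable W) (hD : Measurable D)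
    (hp : ∫ y, W y ∂U = p) (hp0 : 0 < p) (hq : ∫ y, D y * W y ∂U = q) (v : ℝ≥0) :
    ∫ X, noiseRisk W f c v X ∂Measure.pi (fun _ : Fin n => U) ≤
      4 * ((M ^ 2 * d ^ 2 + 2 * v + B ^ 2) / (n * p) + M ^ 2 * (q / p) ^ 2) := by
  have hn' : (0 : ℝ) < n := by exact_mod_cast hn
  set t := n * p with ht
  have ht0 : 0 < t := mul_pos hn' hp0
  have hWb : ∀ y, |W y| ≤ 1 := fun y => by rw [abs_of_nonneg (hW0 y)]; exact hW1 y
  have hDWb : ∀ y, |D y * W y| ≤ d := fun y => by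
    rw [abs_of_nonneg (mul_nonneg (hD0 y) (hW0 y))]
    exact (mul_le_of_le_one_right (hD0 y) (hW1 y)).trans (hDd y)
  have hDW : Measurable fun y => D y * W y := hD.mul hW
  have hWI : Integrable W U := integrable_of_measurable_bounded hW hWb
  have hW2 : ∫ y, W y ^ 2 ∂U ≤ p := by
    rw [← hp]
    refine integral_mono_of_nonneg (.of_forall fun y => sq_nonneg _) hWI (.of_forall fun y => ?_)
    exact pow_le_of_le_one (hW0 y) (hW1 y) two_ne_zero
  have hDW2 : ∫ y, (D y * W y) ^ 2 ∂U ≤ d ^ 2 * p := by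
    rw [← hp, ← integral_const_mul]
    refine integral_mono_of_nonneg (.of_forall fun y => sq_nonneg _) (hWI.const_mul _)
      (.of_forall fun y => ?_)
    simp only [mul_pow]
    exact mul_le_mul (pow_le_pow_left₀ (hD0 y) (hDd y) 2)
      (pow_le_of_le_one (hW0 y) (hW1 y) two_ne_zero) (sq_nonneg _) (sq_nonneg _)
  have hI1 : Integrable (fun X : Fin n → E => (∑ i, D (X i) * W (X i)) ^ 2)
      (Measure.pi fun _ : Fin n => U) := by
    refine integrable_of_measurable_bounded (c := (n * d) ^ 2)
      ((measurable_sum_comp hDW).pow_const 2) fun X => ?_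
    rw [abs_pow]
    exact pow_le_pow_left₀ (abs_nonneg _) (abs_sum_comp_le hDWb X) 2
  have hI2 : Integrable (fun X : Fin n → E => ∑ i, W (X i)) (Measure.pi fun _ : Fin n => U) :=
    integrable_of_measurable_bounded (measurable_sum_comp hW) (abs_sum_comp_le hWb)
  have hI3 : Integrable (fun X : Fin n → E => (∑ i, W (X i) - t) ^ 2)
      (Measure.pi fun _ : Fin n => U) := by
    refine integrable_of_measurable_bounded (c := (n * 1 + |t|) ^ 2)
      (((measurable_sum_comp hW).sub_const t).pow_const 2) fun X => ?_
    rw [abs_pow]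
    exact pow_le_pow_left₀ (abs_nonneg _)
      ((abs_sub _ _).trans (add_le_add_left (abs_sum_comp_le hWb X) _)) 2
  have hJ1 := integral_sum_sq_le (U := U) (n := n) hDW hDWb
  have hJ2 := integral_sum_pi (U := U) (n := n) hW hWb
  have hJ3 := integral_sum_sub_sq_le (U := U) (n := n) hW hWb
  rw [hq] at hJ1
  rw [hp, ← ht] at hJ2 hJ3
  have hv := v.coe_nonneg
  calc ∫ X, noiseRisk W f c v X ∂Measure.pi (fun _ : Fin n => U)
      ≤ ∫ X, 4 / t ^ 2 * (M ^ 2 * (∑ i, D (X i) * W (X i)) ^ 2 +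
          v * ∑ i, W (X i) + (B ^ 2 + v) * (∑ i, W (X i) - t) ^ 2)
          ∂Measure.pi (fun _ : Fin n => U) := by
        refine integral_mono_of_nonneg (.of_forall fun X => ?_) ?_
          (.of_forall fun X => noiseRisk_le_of_mean hW0 hW1 hfD hMD hcB v ht0 X)
        · exact add_nonneg (sq_nonneg _)
            (mul_nonneg hv (Finset.sum_nonneg fun i _ => sq_nonneg _))
        · exact (((hI1.const_mul _).add (hI2.const_mul _)).add (hI3.const_mul _)).const_mul _
    _ = 4 / t ^ 2 * (M ^ 2 * ∫ X, (∑ i, D (X i) * W (X i)) ^ 2 ∂Measure.pi (fun _ : Fin n => U) +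
          v * t + (B ^ 2 + v) *
            ∫ X, (∑ i, W (X i) - t) ^ 2 ∂Measure.pi (fun _ : Fin n => U)) := by
        have hI12 := (hI1.const_mul (M ^ 2)).add (hI2.const_mul (v : ℝ))
        simp only [Pi.add_def] at hI12
        rw [integral_const_mul, integral_add hI12 (hI3.const_mul _),
          integral_add (hI1.const_mul _) (hI2.const_mul _),
          integral_const_mul, integral_const_mul, integral_const_mul, hJ2]
    _ ≤ 4 / t ^ 2 * (M ^ 2 * (n * (d ^ 2 * p) + (n * q) ^ 2) + v * t + (B ^ 2 + v) * (n * p)) := by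
        gcongr
        · exact hJ1.trans (by gcongr)
        · exact hJ3.trans (by gcongr)
    _ = _ := by
        rw [ht]
        field_simp
        ring

/-- Integrating out the noise by Fubini's theorem. -/
lemma integral_kernelError_sq {W f : E → ℝ} {c C : ℝ} (hW : Measurable W) (hf : Measurable f)
    (v : ℝ≥0) (hC : ∀ X : Fin n → E, noiseRisk W f c v X ≤ C) :
    Integrable (fun p : (Fin n → E) × (Fin n → ℝ) => kernelError W f c p.1 p.2 ^ 2)
        ((Measure.pi fun _ => U).prod (Measure.pi fun _ => gaussianReal 0 v)) ∧
      ∫ p, kernelError W f c p.1 p.2 ^ 2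
        ∂((Measure.pi fun _ : Fin n => U).prod (Measure.pi fun _ => gaussianReal 0 v)) =
      ∫ X, noiseRisk W f c v X ∂Measure.pi fun _ : Fin n => U := by
  have hm := (measurable_kernelError (n := n) hW hf c).pow_const 2
  have hin (X : Fin n → E) :
      Integrable (fun e => kernelError W f c X e ^ 2) (Measure.pi fun _ => gaussianReal 0 v) ∧
        ∫ e, kernelError W f c X e ^ 2 ∂(Measure.pi fun _ => gaussianReal 0 v) =
          noiseRisk W f c v X := by
    simp only [kernelError_eq]
    exact integral_affine_gaussian_sq v _ _
  have h0 (X : Fin n → E) : 0 ≤ noiseRisk W f c v X := by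
    rw [← (hin X).2]; exact integral_nonneg fun e => sq_nonneg _
  have hI : Integrable (fun p : (Fin n → E) × (Fin n → ℝ) => kernelError W f c p.1 p.2 ^ 2)
      ((Measure.pi fun _ => U).prod (Measure.pi fun _ => gaussianReal 0 v)) := by
    refine (integrable_prod_iff hm.aestronglyMeasurable).2
      ⟨.of_forall fun X => (hin X).1, ?_⟩
    simp only [Real.norm_of_nonneg (sq_nonneg _), (hin _).2]
    exact integrable_of_measurable_bounded (c := C) (measurable_noiseRisk hW hf c v)
      fun X => by rw [abs_of_nonneg (h0 X)]; exact hC X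
  refine ⟨hI, ?_⟩
  rw [integral_prod _ hI]
  simp only [(hin _).2]

end KernelRegression

/-! ### Risk of the translation-invariant uniform KeRF estimate -/

section Sample

variable {Ω E : Type*} [MeasurableSpace Ω] [MeasurableSpace E] {μ : Measure Ω}
  [IsProbabilityMeasure μ] {U : Measure E} [IsProbabilityMeasure U] {n : ℕ}

/-- The points and the noises of the sample are jointly distributed as independent families. -/
lemma measurePreserving_sample {X : Fin n → Ω → E} {ε : Fin n → Ω → ℝ} {γ : Measure ℝ}
    [IsProbabilityMeasure γ] (hX : ∀ i, Measurable (X i)) (hε : ∀ i, Measurable (ε i))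
    (hXlaw : ∀ i, μ.map (X i) = U) (hεlaw : ∀ i, μ.map (ε i) = γ)
    (hind : ∀ i, IndepFun (X i) (ε i) μ) (hiind : iIndepFun (fun i ω => (X i ω, ε i ω)) μ) :
    MeasurePreserving (fun ω => ((fun i => X i ω), (fun i => ε i ω))) μ
      ((Measure.pi fun _ : Fin n => U).prod (Measure.pi fun _ : Fin n => γ)) := by
  have h1 : MeasurePreserving (fun ω i => (X i ω, ε i ω)) μ
      (Measure.pi fun _ : Fin n => U.prod γ) := by
    refine ⟨measurable_pi_lambda _ fun i => (hX i).prodMk (hε i), ?_⟩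
    rw [hiind.map_fun_eq_pi_map fun i => ((hX i).prodMk (hε i)).aemeasurable]
    congr
    funext i
    rw [(indepFun_iff_map_prod_eq_prod_map_map (hX i).aemeasurable (hε i).aemeasurable).1 (hind i),
      hXlaw, hεlaw]
  exact (measurePreserving_arrowProdEquivProdArrow E ℝ (Fin n) (fun _ => U) (fun _ => γ)).comp h1

end Sample

/-- The nearest-point projection onto the cube, coordinate by coordinate. Composing with it extends a
function that is Lipschitz on the cube to a continuous, hence measurable, function. -/
noncomputable def cubeProj {d : ℕ} (y : Fin d → ℝ) : Fin d → ℝ := fun j => max 0 (min 1 (y j))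

section CubeProj

variable {d : ℕ}

lemma cubeProj_mem (y : Fin d → ℝ) : cubeProj y ∈ Set.Icc (0 : Fin d → ℝ) 1 :=
  ⟨fun _ => le_max_left _ _, fun _ => max_le zero_le_one (min_le_left _ _)⟩

lemma cubeProj_of_mem {y : Fin d → ℝ} (hy : y ∈ Set.Icc (0 : Fin d → ℝ) 1) : cubeProj y = y := by
  funext j
  have h0 : 0 ≤ y j := hy.1 j
  have h1 : y j ≤ 1 := hy.2 j
  simp [cubeProj, h0, h1]

lemma abs_cubeProj_sub_le (y y' : Fin d → ℝ) (j : Fin d) :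
    |cubeProj y j - cubeProj y' j| ≤ |y j - y' j| := by
  unfold cubeProj
  refine (abs_max_sub_max_le_max _ _ _ _).trans ?_
  simp only [sub_self, abs_zero]
  refine max_le (abs_nonneg _) ((abs_min_sub_min_le_max _ _ _ _).trans ?_)
  simp

variable {m : (Fin d → ℝ) → ℝ} {L : ℝ}

lemma continuous_comp_cubeProj
    (hm : ∀ x ∈ Set.Icc (0 : Fin d → ℝ) 1, ∀ x' ∈ Set.Icc (0 : Fin d → ℝ) 1,
      |m x - m x'| ≤ L * ∑ j, |x j - x' j|) : Continuous fun y => m (cubeProj y) := by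
  refine (LipschitzWith.of_dist_le_mul (K := ⟨|L| * d, by positivity⟩) fun y y' => ?_).continuous
  rw [Real.dist_eq]
  calc _ ≤ L * ∑ j, |cubeProj y j - cubeProj y' j| := hm _ (cubeProj_mem y) _ (cubeProj_mem y')
    _ ≤ |L| * ∑ j : Fin d, dist y y' := by
        refine mul_le_mul (le_abs_self L) (Finset.sum_le_sum fun j _ => ?_)
          (Finset.sum_nonneg fun j _ => abs_nonneg _) (abs_nonneg L)
        exact (abs_cubeProj_sub_le y y' j).trans (dist_le_pi_dist y y' j)
    _ = |L| * d * dist y y' := by simp [mul_assoc]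

lemma abs_comp_cubeProj_sub_le
    (hm : ∀ x ∈ Set.Icc (0 : Fin d → ℝ) 1, ∀ x' ∈ Set.Icc (0 : Fin d → ℝ) 1,
      |m x - m x'| ≤ L * ∑ j, |x j - x' j|) {x : Fin d → ℝ}
    (hx : x ∈ Set.Icc (0 : Fin d → ℝ) 1) (y : Fin d → ℝ) :
    |m (cubeProj y) - m x| ≤ |L| * truncDist x y := by
  refine (hm _ (cubeProj_mem y) x hx).trans ?_
  refine mul_le_mul (le_abs_self L) (Finset.sum_le_sum fun j _ => le_min ?_ ?_)
    (Finset.sum_nonneg fun j _ => abs_nonneg _) (abs_nonneg L)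
  · conv_lhs => rw [← cubeProj_of_mem hx]
    exact abs_cubeProj_sub_le y x j
  · exact abs_sub_le_one_of_mem_cube hx (cubeProj_mem y) j

lemma abs_le_of_lipschitz_cube
    (hm : ∀ x ∈ Set.Icc (0 : Fin d → ℝ) 1, ∀ x' ∈ Set.Icc (0 : Fin d → ℝ) 1,
      |m x - m x'| ≤ L * ∑ j, |x j - x' j|) {x : Fin d → ℝ}
    (hx : x ∈ Set.Icc (0 : Fin d → ℝ) 1) : |m x| ≤ |m 0| + |L| * d := by
  have h0 : (0 : Fin d → ℝ) ∈ Set.Icc (0 : Fin d → ℝ) 1 := ⟨le_rfl, fun _ => zero_le_one⟩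
  have h := abs_comp_cubeProj_sub_le hm h0 x
  rw [cubeProj_of_mem hx] at h
  have h2 := mul_le_mul_of_nonneg_left (truncDist_le 0 x) (abs_nonneg L)
  linarith [abs_sub_abs_le_abs_sub (m x) (m 0)]

end CubeProj

/-- The risk bound for a fixed sample size `n` and depth `k`: a bound uniform in both, and the sum
of a variance term `2 ^ k / n` and a squared bias term `(1 - 1 / (3 d)) ^ (2 k)`. -/
lemma uniformKeRF_risk {d : ℕ} [NeZero d] {m : (Fin d → ℝ) → ℝ} {L : ℝ}
    (hm : ∀ x ∈ Set.Icc (0 : Fin d → ℝ) 1, ∀ x' ∈ Set.Icc (0 : Fin d → ℝ) 1,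
      |m x - m x'| ≤ L * ∑ j, |x j - x' j|) (v : ℝ≥0) {n : ℕ} (hn : 0 < n) (k : ℕ)
    {Ω : Type*} [MeasurableSpace Ω] {μ : Measure Ω} [IsProbabilityMeasure μ]
    {X : Fin n → Ω → Fin d → ℝ} {ε Y : Fin n → Ω → ℝ}
    (hX : ∀ i, Measurable (X i)) (hε : ∀ i, Measurable (ε i))
    (hXlaw : ∀ i, pdf.IsUniform (X i) (Set.Icc (0 : Fin d → ℝ) 1) μ volume)
    (hεlaw : ∀ i, μ.map (ε i) = gaussianReal 0 v)
    (hind : ∀ i, IndepFun (X i) (ε i) μ) (hiind : iIndepFun (fun i ω => (X i ω, ε i ω)) μ)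
    (hY : ∀ i ω, Y i ω = m (X i ω) + ε i ω) {x : Fin d → ℝ}
    (hx : x ∈ Set.Icc (0 : Fin d → ℝ) 1) :
    Integrable (fun ω => (uniformKeRF k (fun i => X i ω) (fun i => Y i ω) x - m x) ^ 2) μ ∧
    ∫ ω, (uniformKeRF k (fun i => X i ω) (fun i => Y i ω) x - m x) ^ 2 ∂μ ≤
      (|m 0| + |L| * d) ^ 2 + v ∧
    ∫ ω, (uniformKeRF k (fun i => X i ω) (fun i => Y i ω) x - m x) ^ 2 ∂μ ≤
      4 * (L ^ 2 * d ^ 2 + 2 * v + (|m 0| + |L| * d) ^ 2) * (2 ^ k / n) +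
        4 * L ^ 2 * (d * 2 ^ d) ^ 2 * (1 - 1 / (3 * (d : ℝ))) ^ (2 * k) := by
  set B := |m 0| + |L| * d with hB
  have hlaw (i : Fin n) : μ.map (X i) = cubeLaw d := by
    have h : μ.map (X i) = cond volume (Set.Icc (0 : Fin d → ℝ) 1) := hXlaw i
    rw [h, ProbabilityTheory.cond, volume_cube, inv_one, one_smul]
  have hmp := measurePreserving_sample hX hε hlaw hεlaw hind hiind
  set W := shiftKernel d k x with hWdef
  set f : (Fin d → ℝ) → ℝ := fun y => m (cubeProj y) with hfdef
  have hW : Measurable W := measurable_shiftKernel k x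
  have hf : Measurable f := (continuous_comp_cubeProj hm).measurable
  have hD : Measurable (truncDist x) := measurable_truncDist x
  have hW0 : ∀ y, 0 ≤ W y := shiftKernel_nonneg k x
  have hfD : ∀ y, |f y - m x| ≤ |L| * truncDist x y := abs_comp_cubeProj_sub_le hm hx
  have hMD (y : Fin d → ℝ) : |L| * truncDist x y ≤ B := by
    have := mul_le_mul_of_nonneg_left (truncDist_le x y) (abs_nonneg L)
    linarith [abs_nonneg (m 0)]
  have hcB : |m x| ≤ B := abs_le_of_lipschitz_cube hm hx
  have hcrude : ∀ S : Fin n → Fin d → ℝ, noiseRisk W f (m x) v S ≤ B ^ 2 + v :=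
    noiseRisk_le hW0 hfD hMD hcB v
  obtain ⟨hI, hE⟩ := integral_kernelError_sq (U := cubeLaw d) hW hf v hcrude
  have hae : (fun ω => (uniformKeRF k (fun i => X i ω) (fun i => Y i ω) x - m x) ^ 2) =ᵐ[μ]
      fun ω => kernelError W f (m x) (fun i => X i ω) (fun i => ε i ω) ^ 2 := by
    have hcube : ∀ᵐ ω ∂μ, ∀ i, X i ω ∈ Set.Icc (0 : Fin d → ℝ) 1 := ae_all_iff.2 fun i => by
      refine ae_of_ae_map (hX i).aemeasurable ?_
      rw [hlaw i]
      exact ae_restrict_mem measurableSet_Icc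
    filter_upwards [hcube] with ω hω
    simp only [uniformKeRF, kernelError, hY, hfdef, hWdef, cubeProj_of_mem (hω _),
      uniformKernel_eq_shiftKernel hx (hω _)]
  have hval : ∫ ω, (uniformKeRF k (fun i => X i ω) (fun i => Y i ω) x - m x) ^ 2 ∂μ =
      ∫ S, noiseRisk W f (m x) v S ∂Measure.pi fun _ : Fin n => cubeLaw d := by
    rw [integral_congr_ae hae, ← hE, ← hmp.map_eq,
      integral_map hmp.measurable.aemeasurable
        ((measurable_kernelError hW hf (m x)).pow_const 2).aestronglyMeasurable]
  refine ⟨(hmp.integrable_comp_of_integrable hI).congr hae.symm, ?_, ?_⟩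
  · rw [hval]
    refine (integral_mono_of_nonneg (.of_forall fun S => ?_) (integrable_const (B ^ 2 + (v : ℝ)))
      (.of_forall hcrude)).trans (by simp)
    exact add_nonneg (sq_nonneg _)
      (mul_nonneg v.coe_nonneg (Finset.sum_nonneg fun i _ => sq_nonneg _))
  · set p := ∫ y, W y ∂cubeLaw d with hp
    set q := ∫ y, truncDist x y * W y ∂cubeLaw d with hq
    have hple : (1 / 2) ^ k ≤ p := le_integral_shiftKernel k hx
    have hqle : q ≤ d * 2 ^ d * ((1 - 1 / (3 * (d : ℝ))) / 2) ^ k :=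
      integral_truncDist_mul_shiftKernel_le k hx
    have hp0 : 0 < p := lt_of_lt_of_le (by positivity) hple
    have hq0 : 0 ≤ q := integral_nonneg fun y => mul_nonneg (truncDist_nonneg x y) (hW0 y)
    have hn' : (0 : ℝ) < n := by exact_mod_cast hn
    have h1 : 1 / (n * p) ≤ 2 ^ k / n := by
      rw [div_le_div_iff₀ (by positivity) hn', one_mul]
      calc (n : ℝ) = 2 ^ k * (n * (1 / 2) ^ k) := by
            rw [one_div, inv_pow]; field_simp
        _ ≤ 2 ^ k * (n * p) := by gcongr
    have h2 : q / p ≤ d * 2 ^ d * (1 - 1 / (3 * (d : ℝ))) ^ k := by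
      calc q / p ≤ (d * 2 ^ d * ((1 - 1 / (3 * (d : ℝ))) / 2) ^ k) / (1 / 2) ^ k :=
            div_le_div₀ (hq0.trans hqle) hqle (by positivity) hple
        _ = _ := by rw [div_pow, div_pow, one_pow]; field_simp
    have h3 : (q / p) ^ 2 ≤ (d * 2 ^ d * (1 - 1 / (3 * (d : ℝ))) ^ k) ^ 2 :=
      pow_le_pow_left₀ (div_nonneg hq0 hp0.le) h2 2
    rw [hval]
    refine (integral_noiseRisk_le (U := cubeLaw d) hn hW0 (shiftKernel_le_one k x)
      (truncDist_nonneg x) (truncDist_le x) hfD hMD hcB hW hD hp.symm hp0 hq.symm v).trans ?_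
    rw [sq_abs]
    calc _ = 4 * (L ^ 2 * d ^ 2 + 2 * v + B ^ 2) * (1 / (n * p)) + 4 * L ^ 2 * (q / p) ^ 2 := by
          ring
      _ ≤ 4 * (L ^ 2 * d ^ 2 + 2 * v + B ^ 2) * (2 ^ k / n) +
          4 * L ^ 2 * (d * 2 ^ d * (1 - 1 / (3 * (d : ℝ))) ^ k) ^ 2 := by gcongr
      _ = _ := by ring

/-! ### Asymptotics of the depth -/

section Depth

open Real Topology

variable (d : ℕ) [NeZero d]

/-- The factor by which one round of splits shrinks the mean bias lies strictly between `0`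
and `1`. -/
lemma shrink_mem : 1 - 1 / (3 * (d : ℝ)) ∈ Set.Ioo (0 : ℝ) 1 := by
  have h : (1 : ℝ) ≤ d := by exact_mod_cast NeZero.one_le
  have h2 : 1 / (3 * (d : ℝ)) ≤ 1 / 3 := by
    apply one_div_le_one_div_of_le <;> linarith
  have h3 : 0 < 1 / (3 * (d : ℝ)) := by positivity
  constructor <;> linarith

/-- The limit of `depth / log₂ n`, the value at which `2 ^ k / n` and `(1 - 1 / (3 d)) ^ (2 k)` are
powers of `n` with the same exponent. -/
noncomputable def depthSlope (d : ℕ) : ℝ := 1 / (1 - 2 * logb 2 (1 - 1 / (3 * (d : ℝ))))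

lemma logb_shrink_neg : logb 2 (1 - 1 / (3 * (d : ℝ))) < 0 :=
  logb_neg one_lt_two (shrink_mem d).1 (shrink_mem d).2

lemma depthSlope_pos : 0 < depthSlope d :=
  one_div_pos.2 (by linarith [logb_shrink_neg d])

lemma tendsto_depth_arg_div_log :
    Tendsto (fun n : ℕ => (1 / log n - 1) /
      (2 * logb 2 (1 - 1 / (3 * (d : ℝ))) - (1 - 1 / log n)) *
        logb 2 ((n : ℝ) / log n ^ ((1 / log n) / (1 - 1 / log n))) / log n) atTop
      (𝓝 (depthSlope d / log 2)) := by
  have hneg := logb_shrink_neg d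
  set b := logb 2 (1 - 1 / (3 * (d : ℝ))) with hb
  have ht : Tendsto (fun n : ℕ => log n) atTop atTop :=
    tendsto_log_atTop.comp tendsto_natCast_atTop_atTop
  have hinv : Tendsto (fun t : ℝ => 1 / t) atTop (𝓝 0) := by
    simpa using tendsto_inv_atTop_zero
  have hA : Tendsto (fun t : ℝ => (1 / t - 1) / (2 * b - (1 - 1 / t))) atTop
      (𝓝 ((0 - 1) / (2 * b - (1 - 0)))) :=
    (hinv.sub_const 1).div ((hinv.const_sub 1).const_sub _) (by linarith)
  have hlog : Tendsto (fun t : ℝ => log t / t) atTop (𝓝 0) :=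
    isLittleO_log_id_atTop.tendsto_div_nhds_zero
  have hB : Tendsto (fun t : ℝ => (1 - (1 / t) / (1 - 1 / t) * (log t / t)) / log 2) atTop
      (𝓝 ((1 - 0 / (1 - 0) * 0) / log 2)) :=
    (((hinv.div (hinv.const_sub 1) (by norm_num)).mul hlog).const_sub 1).div_const _
  have h := (hA.mul hB).comp ht
  have hlim : (0 - 1) / (2 * b - (1 - 0)) * ((1 - 0 / (1 - 0) * 0) / log 2) =
      depthSlope d / log 2 := by
    rw [depthSlope, ← hb]
    have h1 : 2 * b - (1 - 0) ≠ 0 := by linarith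
    have h2 : 1 - 2 * b ≠ 0 := by linarith
    have h3 : log 2 ≠ 0 := (log_pos one_lt_two).ne'
    field_simp
    ring
  rw [hlim] at h
  refine h.congr' ?_
  filter_upwards [ht.eventually_gt_atTop 0, eventually_gt_atTop 0] with n hn hn0
  have hnp : (n : ℝ) ≠ 0 := by positivity
  have h3 : log 2 ≠ 0 := (log_pos one_lt_two).ne'
  simp only [Function.comp]
  rw [logb, log_div hnp (rpow_pos_of_pos hn _).ne', log_rpow hn]
  rw [mul_div_assoc]
  congr 1
  field_simp

lemma tendsto_depth_arg :
    Tendsto (fun n : ℕ => (1 / log n - 1) /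
      (2 * logb 2 (1 - 1 / (3 * (d : ℝ))) - (1 - 1 / log n)) *
        logb 2 ((n : ℝ) / log n ^ ((1 / log n) / (1 - 1 / log n)))) atTop atTop := by
  have ht : Tendsto (fun n : ℕ => log n) atTop atTop :=
    tendsto_log_atTop.comp tendsto_natCast_atTop_atTop
  have hpos : 0 < depthSlope d / log 2 := div_pos (depthSlope_pos d) (log_pos one_lt_two)
  refine ((tendsto_depth_arg_div_log d).pos_mul_atTop hpos ht).congr' ?_
  filter_upwards [ht.eventually_gt_atTop 0] with n hn
  rw [div_mul_cancel₀ _ hn.ne']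

lemma tendsto_uniformDepth : Tendsto (uniformDepth d) atTop atTop :=
  tendsto_atTop_mono (fun _ => le_max_right _ _)
    (tendsto_nat_ceil_atTop.comp (tendsto_depth_arg d))

lemma tendsto_uniformDepth_div_log :
    Tendsto (fun n : ℕ => (uniformDepth d n : ℝ) / log n) atTop (𝓝 (depthSlope d / log 2)) := by
  have h := ((tendsto_nat_ceil_div_atTop (R := ℝ)).comp (tendsto_depth_arg d)).mul
    (tendsto_depth_arg_div_log d)
  rw [one_mul] at h
  refine h.congr' ?_
  filter_upwards [(tendsto_depth_arg d).eventually_gt_atTop 0] with n hn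
  simp only [Function.comp, uniformDepth]
  rw [max_eq_right (Nat.one_le_iff_ne_zero.2 (Nat.ceil_pos.2 hn).ne'),
    div_mul_div_cancel₀ hn.ne']

/-- The balanced exponent is strictly better than the exponent of the rate: this is
`log y < y - 1` at `y = 1 - 1 / (3 d)`. -/
lemma rate_lt_one_sub_depthSlope :
    1 / (1 + 3 / 2 * (d : ℝ) * log 2) < 1 - depthSlope d := by
  have hd : (0 : ℝ) < d := by exact_mod_cast NeZero.pos d
  have h2 : 0 < log 2 := log_pos one_lt_two
  have hρ := shrink_mem d
  have hl : log (1 - 1 / (3 * (d : ℝ))) < -(1 / (3 * (d : ℝ))) := by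
    have := log_lt_sub_one_of_pos hρ.1 hρ.2.ne
    linarith
  set l := log (1 - 1 / (3 * (d : ℝ))) with hldef
  have hl' : 1 < -l * (3 * d) := by
    have h : 1 / (3 * (d : ℝ)) < -l := by linarith
    rwa [div_lt_iff₀ (by positivity)] at h
  have hl0 : l < 0 := by
    have : 0 < 1 / (3 * (d : ℝ)) := by positivity
    linarith
  have hs : 1 - depthSlope d = -2 * l / (log 2 - 2 * l) := by
    rw [depthSlope, logb, ← hldef]
    have h5 : log 2 - 2 * l ≠ 0 := by linarith
    have h6 : 1 - 2 * (l / log 2) = (log 2 - 2 * l) / log 2 := by field_simp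
    rw [h6, one_div_div]
    field_simp
    ring
  rw [hs, div_lt_div_iff₀ (by positivity) (by linarith)]
  nlinarith

/-- At the chosen depth, both error terms are eventually below the rate. -/
lemma eventually_depth_terms_le :
    ∀ᶠ n : ℕ in atTop,
      (2 : ℝ) ^ uniformDepth d n / n ≤ (n : ℝ) ^ (-(1 / (1 + 3 / 2 * (d : ℝ) * log 2))) ∧
      (1 - 1 / (3 * (d : ℝ))) ^ (2 * uniformDepth d n) ≤
        (n : ℝ) ^ (-(1 / (1 + 3 / 2 * (d : ℝ) * log 2))) := by
  have hr := rate_lt_one_sub_depthSlope d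
  set r := 1 / (1 + 3 / 2 * (d : ℝ) * log 2) with hrdef
  have hρ := (shrink_mem d).1
  have hneg := logb_shrink_neg d
  have h2 : log 2 ≠ 0 := (log_pos one_lt_two).ne'
  have hk := tendsto_uniformDepth_div_log d
  have h1 := (hk.mul_const (log 2)).sub_const 1
  have h3 := hk.mul_const (2 * log (1 - 1 / (3 * (d : ℝ))))
  have e1 : depthSlope d / log 2 * log 2 - 1 < -r := by
    rw [div_mul_cancel₀ _ h2]; linarith
  have e3 : depthSlope d / log 2 * (2 * log (1 - 1 / (3 * (d : ℝ)))) < -r := by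
    have : depthSlope d / log 2 * (2 * log (1 - 1 / (3 * (d : ℝ)))) = depthSlope d - 1 := by
      have h5 : 1 - 2 * logb 2 (1 - 1 / (3 * (d : ℝ))) ≠ 0 := by linarith
      have h6 : log (1 - 1 / (3 * (d : ℝ))) = logb 2 (1 - 1 / (3 * (d : ℝ))) * log 2 := by
        rw [logb, div_mul_cancel₀ _ h2]
      rw [h6, depthSlope]
      generalize logb 2 (1 - 1 / (3 * (d : ℝ))) = b at h5
      field_simp
      ring
    linarith
  have ht : Tendsto (fun n : ℕ => log n) atTop atTop :=
    tendsto_log_atTop.comp tendsto_natCast_atTop_atTop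
  filter_upwards [h1.eventually_lt_const e1, h3.eventually_lt_const e3,
    ht.eventually_gt_atTop 0, eventually_gt_atTop 0] with n hn1 hn3 hlog hn0
  have hnp : (0 : ℝ) < n := by exact_mod_cast hn0
  have hk0 : (uniformDepth d n : ℝ) = uniformDepth d n / log n * log n := by
    rw [div_mul_cancel₀ _ hlog.ne']
  set θ := (uniformDepth d n : ℝ) / log n with hθ
  rw [rpow_def_of_pos hnp]
  constructor
  · rw [← exp_log (show (0 : ℝ) < 2 ^ uniformDepth d n / n by positivity), exp_le_exp,
      log_div (by positivity) hnp.ne', log_pow, hk0]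
    nlinarith
  · rw [← exp_log (pow_pos hρ (2 * uniformDepth d n)), exp_le_exp, log_pow]
    push_cast
    rw [hk0]
    nlinarith

end Depth

/-! ### The rate of convergence -/

theorem theorem2 (d : ℕ) [NeZero d] :
    Tendsto (uniformDepth d) atTop atTop ∧
    ∀ (m : (Fin d → ℝ) → ℝ) (L : ℝ),
      (∀ x ∈ Set.Icc (0 : Fin d → ℝ) 1, ∀ x' ∈ Set.Icc (0 : Fin d → ℝ) 1,
        |m x - m x'| ≤ L * ∑ j, |x j - x' j|) →
      ∀ v : ℝ≥0, ∃ C : ℝ, ∀ n : ℕ, 1 < n →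
        ∀ (Ω : Type*) [MeasurableSpace Ω] (μ : Measure Ω) [IsProbabilityMeasure μ]
          (X : Fin n → Ω → Fin d → ℝ) (ε Y : Fin n → Ω → ℝ),
          (∀ i, Measurable (X i)) → (∀ i, Measurable (ε i)) →
          (∀ i, pdf.IsUniform (X i) (Set.Icc (0 : Fin d → ℝ) 1) μ volume) →
          (∀ i, μ.map (ε i) = gaussianReal 0 v) →
          (∀ i, IndepFun (X i) (ε i) μ) →
          iIndepFun (fun i ω => (X i ω, ε i ω)) μ →
          (∀ i ω, Y i ω = m (X i ω) + ε i ω) →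
          ∀ x ∈ Set.Icc (0 : Fin d → ℝ) 1,
            Integrable (fun ω =>
              (uniformKeRF (uniformDepth d n) (fun i => X i ω) (fun i => Y i ω) x - m x) ^ 2) μ ∧
            ∫ ω, (uniformKeRF (uniformDepth d n) (fun i => X i ω) (fun i => Y i ω) x - m x) ^ 2 ∂μ
              ≤ C * (n : ℝ) ^ (-(1 / (1 + 3 / 2 * (d : ℝ) * Real.log 2))) * Real.log n := by
  refine ⟨tendsto_uniformDepth d, fun m L hm v => ?_⟩
  have hlog : ∀ᶠ n : ℕ in atTop, 1 ≤ Real.log n :=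
    (Real.tendsto_log_atTop.comp tendsto_natCast_atTop_atTop).eventually_ge_atTop 1
  obtain ⟨N, hN⟩ := eventually_atTop.1 ((eventually_depth_terms_le d).and hlog)
  set r := -(1 / (1 + 3 / 2 * (d : ℝ) * Real.log 2)) with hr
  set A := (|m 0| + |L| * d) ^ 2 + (v : ℝ) with hA
  have hA0 : 0 ≤ A := by positivity
  set C₁ := 4 * (L ^ 2 * d ^ 2 + 2 * v + (|m 0| + |L| * d) ^ 2) + 4 * L ^ 2 * (d * 2 ^ d) ^ 2
    with hC₁
  have hC₁0 : 0 ≤ C₁ := by positivity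
  -- The second part of the constant covers the finitely many small `n` by the uniform bound.
  set C₂ := ∑ n ∈ Finset.range N, A / ((n : ℝ) ^ r * Real.log n) with hC₂
  have hterm : ∀ n ∈ Finset.range N, 0 ≤ A / ((n : ℝ) ^ r * Real.log n) := fun n _ =>
    div_nonneg hA0 (mul_nonneg (by positivity) (Real.log_natCast_nonneg n))
  have hC₂0 : 0 ≤ C₂ := Finset.sum_nonneg hterm
  refine ⟨C₁ + C₂, fun n hn Ω _ μ _ X ε Y hX hε hXlaw hεlaw hind hiind hY x hx => ?_⟩
  obtain ⟨hI, hcrude, hfine⟩ := uniformKeRF_risk hm v (by omega) (uniformDepth d n) hX hε hXlaw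
    hεlaw hind hiind hY hx
  refine ⟨hI, ?_⟩
  have hn1 : (1 : ℝ) < n := by exact_mod_cast hn
  have hrate : 0 < (n : ℝ) ^ r := by positivity
  have hlogn : 0 < Real.log n := Real.log_pos hn1
  rcases lt_or_ge n N with hlt | hge
  · have h1 : A / ((n : ℝ) ^ r * Real.log n) ≤ C₁ + C₂ :=
      (Finset.single_le_sum hterm (Finset.mem_range.2 hlt)).trans (by linarith)
    rw [div_le_iff₀ (by positivity), ← mul_assoc] at h1
    exact hcrude.trans h1
  · obtain ⟨⟨hvar, hbias⟩, hlog1⟩ := hN n hge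
    calc _ ≤ _ := hfine
      _ ≤ 4 * (L ^ 2 * d ^ 2 + 2 * v + (|m 0| + |L| * d) ^ 2) * (n : ℝ) ^ r +
          4 * L ^ 2 * (d * 2 ^ d) ^ 2 * (n : ℝ) ^ r := by gcongr
      _ = C₁ * (n : ℝ) ^ r := by rw [hC₁]; ring
      _ ≤ (C₁ + C₂) * (n : ℝ) ^ r := by gcongr; linarith
      _ ≤ (C₁ + C₂) * (n : ℝ) ^ r * Real.log n :=
          le_mul_of_one_le_right (by positivity) hlog1
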